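/- For an $n\times n$ real symmetric matrix $M$, let $M_i$ denote the matrix obtained by deleting the $i$-th row and the $i$-th column of $M$, and let $\mathrm{eigen}(M)=(\lambda_1(M)\ge\lambda_2(M)\ge\cdots\ge\lambda_n(M))$ be the list of its eigenvalues, with multiplicity. Two $n\times n$ real symmetric matrices $A$ and $B$ are called hypomorphic if, for every $i$, the matrix $B_i$ can be obtained from $A_i$ by applying one permutation (which may depend on $i$) simultaneously to the rows and the columns. Let $A$ and $B$ be $n\times n$ real symmetric matrices. (1) Suppose that $\mathrm{eigen}(A)=\mathrm{eigen}(B)$ and $\mathrm{eigen}(A_i)=\mathrm{eigen}(B_i)$ for all $i=1,\dots,n$. Let $\lambda$ be a simple eigenvalue of both $A$ and $B$ (that is, of multiplicity one), let $p=(p_1,\dots,p_n)^t$ be a unit vector in the $\lambda$-eigenspace of $A$, and let $q=(q_1,\dots,q_n)^t$ be a unit vector in the $\lambda$-eigenspace of $B$. Then $p_j^2=q_j^2$ for all $j=1,\dots,n$. (2) (Godsil–McKay) Suppose that $A$ and $B$ are hypomorphic. Let $\lambda$ be a simple eigenvalue of both $A$ and $B$, let $p$ be a unit vector in the $\lambda$-eigenspace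 of $A$, and let $q$ be a unit vector in the $\lambda$-eigenspace of $B$. Then $p_j^2=q_j^2$ for all $j=1,\dots,n$. -/

import Mathlib

namespace Reconstruction

/-- The matrix `A_i`, obtained from `A` by deleting the `i`-th row and the `i`-th column. -/
def deleteRowCol {n : ℕ} (A : Matrix (Fin n) (Fin n) ℝ) (i : Fin n) :
    Matrix {j : Fin n // j ≠ i} {j : Fin n // j ≠ i} ℝ :=
  A.submatrix Subtype.val Subtype.val

theorem deleteRowCol_isSymm {n : ℕ} {A : Matrix (Fin n) (Fin n) ℝ} (hA : A.IsSymm)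
    (i : Fin n) : (deleteRowCol A i).IsSymm :=
  hA.submatrix Subtype.val

theorem isHermitian_of_isSymm {ι : Type*} {M : Matrix ι ι ℝ} (hM : M.IsSymm) :
    M.IsHermitian := by
  rw [Matrix.IsHermitian, Matrix.conjTranspose_eq_transpose_of_trivial]
  exact hM

/-- `eigen M`: the eigenvalues of the real symmetric matrix `M`, repeated according to
multiplicity and listed in decreasing order. -/
noncomputable def eigen {ι : Type*} [Fintype ι] [DecidableEq ι] (M : Matrix ι ι ℝ)
    (hM : M.IsSymm) : Fin (Fintype.card ι) → ℝ :=
  (isHermitian_of_isSymm hM).eigenvalues₀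

/-- `eigenSpace M α`: the eigenspace of `M` for `α`, in Euclidean space. -/
noncomputable def eigenSpace {n : ℕ} (M : Matrix (Fin n) (Fin n) ℝ) (α : ℝ) :
    Submodule ℝ (EuclideanSpace ℝ (Fin n)) :=
  Module.End.eigenspace (Matrix.toEuclideanLin M) α

/-- `α` is a simple eigenvalue of `M`: a root of multiplicity one of the characteristic
polynomial. -/
def IsSimpleEigenvalue {n : ℕ} (M : Matrix (Fin n) (Fin n) ℝ) (α : ℝ) : Prop :=
  M.charpoly.rootMultiplicity α = 1

/-- `A` and `B` are hypomorphic: for each `i`, `B_i` is obtained from `A_i` by a simultaneous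
permutation (which may depend on `i`) of the rows and columns. -/
def Hypomorphic {n : ℕ} (A B : Matrix (Fin n) (Fin n) ℝ) : Prop :=
  ∀ i : Fin n, ∃ σ : Equiv.Perm {j : Fin n // j ≠ i},
    deleteRowCol B i = (deleteRowCol A i).submatrix σ σ

end Reconstruction

/-!
If `v` and `w` are a right and a left null vector of a square matrix `M`, then
`(w ⬝ᵥ v) • adj M = tr (adj M) • v wᵀ`. Apply this to `M = α - A`: the diagonal entries of `adj M`
are the values at `α` of the characteristic polynomials of the matrices `A_i`, and by Jacobi's
formula their sum `tr (adj M)` is the derivative of the characteristic polynomial of `A` at `α`,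
which is nonzero at a simple root. So the products `w i * v i` can be read off from the
characteristic polynomials of the `A_i` once `w ⬝ᵥ v` is given; for symmetric `A`, take `w = v`.
-/

namespace Reconstruction

open Matrix Polynomial

section CommRing

variable {ι R : Type*} [Fintype ι] [DecidableEq ι] [CommRing R]

theorem adjugate_apply_self (M : Matrix ι ι R) (i : ι) :
    M.adjugate i i = (M.toSquareBlockProp (· ≠ i)).det := by
  set N := M.updateRow i (Pi.single i 1) with hN
  have hrest : N.toSquareBlockProp (· ≠ i) = M.toSquareBlockProp (· ≠ i) := by
    ext j k
    simp [hN, toSquareBlockProp, updateRow_ne j.2]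
  have hone : N.toSquareBlockProp (¬ · ≠ i) = 1 := by
    ext ⟨j, hj⟩ ⟨k, hk⟩
    obtain rfl := not_not.mp hj
    obtain rfl := not_not.mp hk
    simp [hN, toSquareBlockProp]
  rw [adjugate_apply, twoBlockTriangular_det N (· ≠ i), hrest, hone, det_one, mul_one]
  intro j hj k hk
  obtain rfl := not_not.mp hj
  simp [hN, hk]

theorem adjugate_charmatrix_apply_self (A : Matrix ι ι R) (i : ι) :
    A.charmatrix.adjugate i i = (A.toSquareBlockProp (· ≠ i)).charpoly := by
  rw [adjugate_apply_self, charpoly]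
  congr 1
  ext1 j k
  simp [toSquareBlockProp, charmatrix_apply, diagonal_apply, Subtype.ext_iff]

theorem adjugate_scalar_sub_apply_self (A : Matrix ι ι R) (α : R) (i : ι) :
    (scalar ι α - A).adjugate i i = (A.toSquareBlockProp (· ≠ i)).charpoly.eval α := by
  rw [adjugate_apply_self, eval_charpoly]
  congr 1
  ext j k
  simp [toSquareBlockProp, diagonal_apply, Subtype.ext_iff]

theorem derivative_det (M : Matrix ι ι R[X]) :
    derivative M.det = (M.adjugate * M.map derivative).trace := by
  have hcol (i : ι) : (M.adjugate * M.map derivative) i i =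
      (M.updateCol i fun k => derivative (M k i)).det := by
    rw [← cramer_apply, cramer_eq_adjugate_mulVec]
    rfl
  have hprod (σ : Equiv.Perm ι) (i : ι) :
      ∏ k, M.updateCol i (fun k => derivative (M k i)) (σ k) k =
        (∏ k ∈ Finset.univ.erase i, M (σ k) k) * derivative (M (σ i) i) := by
    rw [← Finset.prod_erase_mul _ _ (Finset.mem_univ i), updateCol_self]
    congr 1
    exact Finset.prod_congr rfl fun k hk => updateCol_ne (Finset.ne_of_mem_erase hk)
  simp_rw [trace, diag_apply, hcol, det_apply, hprod, derivative_sum, derivative_smul,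
    derivative_prod_finset, Finset.smul_sum]
  exact Finset.sum_comm

theorem derivative_charpoly (A : Matrix ι ι R) :
    derivative A.charpoly = ∑ i, (A.toSquareBlockProp (· ≠ i)).charpoly := by
  have hone : A.charmatrix.map derivative = 1 := by
    ext1 i j
    by_cases hij : i = j <;> simp [hij, one_apply]
  simp_rw [charpoly, derivative_det, hone, mul_one, trace, diag_apply,
    adjugate_charmatrix_apply_self, charpoly]

theorem trace_adjugate_scalar_sub (A : Matrix ι ι R) (α : R) :
    (scalar ι α - A).adjugate.trace = (derivative A.charpoly).eval α := by
  simp_rw [derivative_charpoly, eval_finsetSum, trace, diag_apply, adjugate_scalar_sub_apply_self]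

theorem mul_adjugate_apply_comm_of_mulVec_eq_zero {M : Matrix ι ι R} {v : ι → R}
    (hv : M *ᵥ v = 0) (i j k : ι) :
    v k * M.adjugate i j = v i * M.adjugate k j := by
  -- The `j`-th column of the adjugate does not involve the `j`-th row, which may thus be replaced.
  set N := M.updateRow j (Pi.single k 1) with hN
  have hdet : N.det = M.adjugate k j := (adjugate_apply M k j).symm
  have hadj : N.adjugate i j = M.adjugate i j := by
    rw [adjugate_apply, adjugate_apply, hN, updateRow_idem]
  have hNv : N *ᵥ v = Pi.single j (v k) := by
    ext l
    rcases eq_or_ne l j with rfl | hl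
    · simp [hN, mulVec]
    · simpa [hN, mulVec, hl] using congrFun hv l
  calc v k * M.adjugate i j = (N.adjugate *ᵥ (N *ᵥ v)) i := by
        simp [hNv, hadj, mul_comm]
    _ = v i * M.adjugate k j := by
        simp [mulVec_mulVec, adjugate_mul, smul_mulVec, hdet, mul_comm]

theorem mul_adjugate_apply_comm_of_vecMul_eq_zero {M : Matrix ι ι R} {w : ι → R}
    (hw : w ᵥ* M = 0) (i j k : ι) :
    w k * M.adjugate i j = w j * M.adjugate i k := by
  have h := mul_adjugate_apply_comm_of_mulVec_eq_zero ((mulVec_transpose M w).trans hw) j i k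
  simpa only [← adjugate_transpose, transpose_apply] using h

theorem dotProduct_smul_adjugate {M : Matrix ι ι R} {v w : ι → R}
    (hv : M *ᵥ v = 0) (hw : w ᵥ* M = 0) :
    (w ⬝ᵥ v) • M.adjugate = M.adjugate.trace • vecMulVec v w := by
  ext i j
  calc (w ⬝ᵥ v) * M.adjugate i j = ∑ k, w k * (v k * M.adjugate i j) := by
        simp_rw [dotProduct, Finset.sum_mul, mul_assoc]
    _ = ∑ k, M.adjugate k k * (v i * w j) := Finset.sum_congr rfl fun k _ => by
        rw [mul_adjugate_apply_comm_of_mulVec_eq_zero hv i j k, mul_left_comm,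
          mul_adjugate_apply_comm_of_vecMul_eq_zero hw k j k]
        ring
    _ = M.adjugate.trace * (v i * w j) := by
        simp_rw [trace, diag_apply, Finset.sum_mul]

theorem dotProduct_mul_eval_charpoly_toSquareBlockProp {A : Matrix ι ι R} {α : R} {v w : ι → R}
    (hv : A *ᵥ v = α • v) (hw : w ᵥ* A = α • w) (i : ι) :
    (w ⬝ᵥ v) * (A.toSquareBlockProp (· ≠ i)).charpoly.eval α =
      (derivative A.charpoly).eval α * (w i * v i) := by
  have hv₀ : (scalar ι α - A) *ᵥ v = 0 := by
    rw [sub_mulVec, hv, scalar_apply, ← smul_one_eq_diagonal, smul_mulVec, one_mulVec, sub_self]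
  have hw₀ : w ᵥ* (scalar ι α - A) = 0 := by
    rw [vecMul_sub, hw, scalar_apply, ← smul_one_eq_diagonal, vecMul_smul, vecMul_one, sub_self]
  rw [← adjugate_scalar_sub_apply_self, ← trace_adjugate_scalar_sub, mul_comm (w i)]
  exact congrFun₂ (dotProduct_smul_adjugate hv₀ hw₀) i i

theorem eval_derivative_ne_zero_of_rootMultiplicity_eq_one {f : R[X]} {α : R}
    (hα : f.rootMultiplicity α = 1) : (derivative f).eval α ≠ 0 := by
  have hf : f ≠ 0 := by
    rintro rfl
    simp at hα
  have hroot : f.IsRoot α := (rootMultiplicity_pos hf).mp (hα ▸ one_pos)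
  exact fun h => ((one_lt_rootMultiplicity_iff_isRoot hf).mpr ⟨hroot, h⟩).ne' hα

end CommRing

theorem vecMul_eq_mulVec_of_isSymm {ι R : Type*} [Fintype ι] [NonUnitalCommSemiring R]
    {A : Matrix ι ι R} (hA : A.IsSymm) (v : ι → R) : v ᵥ* A = A *ᵥ v := by
  rw [← mulVec_transpose, hA.eq]

theorem charpoly_eq_of_eigen_eq {ι : Type*} [Fintype ι] [DecidableEq ι] {M N : Matrix ι ι ℝ}
    {hM : M.IsSymm} {hN : N.IsSymm} (h : eigen M hM = eigen N hN) :
    M.charpoly = N.charpoly := by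
  rw [← (isHermitian_of_isSymm hM).eigenvalues_eq_eigenvalues_iff (isHermitian_of_isSymm hN)]
  exact funext fun i => congrFun h _

theorem Hypomorphic.charpoly_deleteRowCol_eq {n : ℕ} {A B : Matrix (Fin n) (Fin n) ℝ}
    (h : Hypomorphic A B) (i : Fin n) :
    (deleteRowCol A i).charpoly = (deleteRowCol B i).charpoly := by
  obtain ⟨σ, hσ⟩ := h i
  rw [hσ]
  exact (charpoly_reindex σ.symm _).symm

theorem mem_eigenSpace_iff {n : ℕ} {A : Matrix (Fin n) (Fin n) ℝ} {α : ℝ}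
    {p : EuclideanSpace ℝ (Fin n)} :
    p ∈ eigenSpace A α ↔ A *ᵥ p.ofLp = α • p.ofLp := by
  rw [eigenSpace, Module.End.mem_eigenspace_iff, ← (WithLp.ofLp_injective 2).eq_iff]
  simp [toEuclideanLin]

theorem dotProduct_self_eq_norm_sq {ι : Type*} [Fintype ι] (p : EuclideanSpace ℝ ι) :
    p.ofLp ⬝ᵥ p.ofLp = ‖p‖ ^ 2 := by
  simp_rw [EuclideanSpace.real_norm_sq_eq, dotProduct, sq]

end Reconstruction

open Matrix Polynomial Reconstruction in
theorem mainTheorem2_general {ι R : Type*} [Fintype ι] [DecidableEq ι] [CommRing R] [IsDomain R]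
    {A B : Matrix ι ι R} {α : R} (hα : A.charpoly.rootMultiplicity α = 1)
    (hdeck : ∀ i, (A.toSquareBlockProp (· ≠ i)).charpoly.eval α =
      (B.toSquareBlockProp (· ≠ i)).charpoly.eval α)
    {v w v' w' : ι → R} (hv : A *ᵥ v = α • v) (hw : w ᵥ* A = α • w)
    (hv' : B *ᵥ v' = α • v') (hw' : w' ᵥ* B = α • w') (hdot : w ⬝ᵥ v = w' ⬝ᵥ v') (i : ι) :
    w i * v i = w' i * v' i := by
  have hderiv : (derivative A.charpoly).eval α = (derivative B.charpoly).eval α := by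
    simp_rw [derivative_charpoly, eval_finsetSum, hdeck]
  refine mul_left_cancel₀ (eval_derivative_ne_zero_of_rootMultiplicity_eq_one hα) ?_
  rw [← dotProduct_mul_eval_charpoly_toSquareBlockProp hv hw, hdeck, hdot, hderiv,
    dotProduct_mul_eval_charpoly_toSquareBlockProp hv' hw']

theorem Reconstruction.sq_apply_eq_of_charpoly_deleteRowCol_eq {n : ℕ}
    {A B : Matrix (Fin n) (Fin n) ℝ} (hA : A.IsSymm) (hB : B.IsSymm)
    (hdeck : ∀ i, (deleteRowCol A i).charpoly = (deleteRowCol B i).charpoly) {α : ℝ}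
    (hα : IsSimpleEigenvalue A α) {p q : EuclideanSpace ℝ (Fin n)} (hp : p ∈ eigenSpace A α)
    (hq : q ∈ eigenSpace B α) (hpq : ‖p‖ = ‖q‖) (j : Fin n) : p j ^ 2 = q j ^ 2 := by
  rw [mem_eigenSpace_iff] at hp hq
  rw [sq, sq]
  -- `deleteRowCol A i` unfolds to `A.toSquareBlockProp (· ≠ i)`.
  exact mainTheorem2_general hα (fun i => congrArg (Polynomial.eval α) (hdeck i))
    hp ((vecMul_eq_mulVec_of_isSymm hA p).trans hp) hq ((vecMul_eq_mulVec_of_isSymm hB q).trans hq)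
    (by rw [dotProduct_self_eq_norm_sq, dotProduct_self_eq_norm_sq, hpq]) j

theorem mainTheorem2 {n : ℕ} (A B : Matrix (Fin n) (Fin n) ℝ) (hA : A.IsSymm) (hB : B.IsSymm) :
    ((Reconstruction.eigen A hA = Reconstruction.eigen B hB ∧
        ∀ i : Fin n,
          Reconstruction.eigen (Reconstruction.deleteRowCol A i)
              (Reconstruction.deleteRowCol_isSymm hA i) =
            Reconstruction.eigen (Reconstruction.deleteRowCol B i)
              (Reconstruction.deleteRowCol_isSymm hB i)) →
      ∀ α : ℝ, Reconstruction.IsSimpleEigenvalue A α → Reconstruction.IsSimpleEigenvalue B α →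
        ∀ p ∈ Reconstruction.eigenSpace A α, ∀ q ∈ Reconstruction.eigenSpace B α,
          ‖p‖ = 1 → ‖q‖ = 1 → ∀ j : Fin n, p j ^ 2 = q j ^ 2) ∧
    (Reconstruction.Hypomorphic A B →
      ∀ α : ℝ, Reconstruction.IsSimpleEigenvalue A α → Reconstruction.IsSimpleEigenvalue B α →
        ∀ p ∈ Reconstruction.eigenSpace A α, ∀ q ∈ Reconstruction.eigenSpace B α,
          ‖p‖ = 1 → ‖q‖ = 1 → ∀ j : Fin n, p j ^ 2 = q j ^ 2) := by
  constructor
  · exact fun h _ hα _ _ hp _ hq hp₁ hq₁ =>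
      Reconstruction.sq_apply_eq_of_charpoly_deleteRowCol_eq hA hB
        (fun i => Reconstruction.charpoly_eq_of_eigen_eq (h.2 i)) hα hp hq (hp₁.trans hq₁.symm)
  · exact fun h _ hα _ _ hp _ hq hp₁ hq₁ =>
      Reconstruction.sq_apply_eq_of_charpoly_deleteRowCol_eq hA hB
        h.charpoly_deleteRowCol_eq hα hp hq (hp₁.trans hq₁.symm)
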